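/- Let $X$ be a standard Borel space and let $\mathcal R$ be a Borel equivalence relation on $X$ (that is, $\mathcal R$ is a Borel subset of $X\times X$) all of whose classes are countable. Let $\mathcal R_1,\mathcal R_2$ be Borel subrelations of $\mathcal R$ (equivalence relations on $X$), and let $\mathcal R_3$ be a Borel equivalence relation on $X$ contained in $\mathcal R_1$ and in $\mathcal R_2$. For $n\ge 2$, call an $n$-tuple $(x_1,\dots,x_n)$ of points of $X$ reduced if - each pair $(x_i,x_{i+1})$, $1\le i\le n-1$, belongs to $\mathcal R_1$ or to $\mathcal R_2$, and for no $j\in\{1,2\}$ do two successive pairs $(x_i,x_{i+1})$, $(x_{i+1},x_{i+2})$ both belong to $\mathcal R_j$; - if $n>2$, no pair $(x_i,x_{i+1})$ belongs to $\mathcal R_3$; - if $n=2$, $x_1\ne x_2$. Suppose that $\mathcal R=\mathcal R_1\star_{\mathcal R_3}\mathcal R_2$ is the amalgamated product of $\mathcal R_1$ and $\mathcal R_2$ over $\mathcal R_3$: $\mathcal R$ is the smallest equivalence relation containing $\mathcal R_1$ and $\mathcal R_2$, and $x_n\ne x_1$ for every reduced tuple $(x_1,\dots,x_n)$. Let $[[\mathcal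 R]]$ be the full pseudogroup of $\mathcal R$: the set of all Borel isomorphisms $\phi:A\to B$ between Borel subsets of $X$ such that $(x,\phi(x))\in\mathcal R$ for all $x\in A$. For $\phi:A\to B$ in $[[\mathcal R]]$ and $i\in\{1,2\}$, let $\phi^{-1}\mathcal R_i\phi$ be the equivalence relation on $A$ for which $x$ and $y$ are equivalent if $(\phi(x),\phi(y))\in\mathcal R_i$. A Borel equivalence relation on a standard Borel space is smooth if some Borel set meets each of its classes in exactly one point. Let $\mathcal S\subseteq\mathcal R$ be a Borel equivalence relation on $X$ such that, for every $\phi:A\to B$ in $[[\mathcal R]]$, the equivalence relations $\phi^{-1}\mathcal R_1\phi\cap\mathcal S$ and $\phi^{-1}\mathcal R_2\phi\cap\mathcal S$ on $A$ are smooth. Then $\mathcal S$ is treeable: there is a Borel, symmetric, irreflexive subset of $X\times X$ that, viewed as a graph on $X$, has no cycles and has the classes of $\mathcal S$ as its connected components. -/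

import Mathlib

namespace BorelRel

/-- The equivalence relation `R` on `X` is Borel: its graph is a Borel subset of `X × X`. -/
def IsBorel {X : Type*} [MeasurableSpace X] (R : Setoid X) : Prop :=
  MeasurableSet {p : X × X | R p.1 p.2}

/-- Every equivalence class of `R` is countable. -/
def HasCountableClasses {X : Type*} (R : Setoid X) : Prop :=
  ∀ x : X, {y : X | R x y}.Countable

/-- `R` is smooth: it has a (Borel) fundamental domain, i.e. a Borel set that meets every
class of `R` in exactly one point. -/
def IsSmooth {X : Type*} [MeasurableSpace X] (R : Setoid X) : Prop :=
  ∃ D : Set X, MeasurableSet D ∧ ∀ x : X, ∃! y : X, y ∈ D ∧ R x y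

/-- `φ` is an element of the full pseudogroup `[[R]]`: a Borel isomorphism from a Borel subset
`φ.source` of `X` onto a Borel subset `φ.target` of `X` whose graph is contained in `R`.
(The values of `φ` off its source and of its inverse off its target play no role.) -/
structure MemFullPseudogroup {X : Type*} [MeasurableSpace X] (R : Setoid X)
    (φ : PartialEquiv X X) : Prop where
  measurableSet_source : MeasurableSet φ.source
  measurableSet_target : MeasurableSet φ.target
  measurable_toFun : Measurable (φ.source.domRestrict φ)
  measurable_invFun : Measurable (φ.target.domRestrict φ.symm)
  graph_subset : ∀ x ∈ φ.source, R x (φ x)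

/-- The relation `φ⁻¹ Q φ` on the domain of `φ`: two points `x`, `y` of `φ.source` are equivalent
if `φ x` and `φ y` are `Q`-equivalent. -/
def conj {X : Type*} (φ : PartialEquiv X X) (Q : Setoid X) : Setoid φ.source :=
  Q.comap (φ.source.domRestrict φ)

/-- The restriction of `S` to the subset `A`. -/
def restrict {X : Type*} (S : Setoid X) (A : Set X) : Setoid A :=
  S.comap Subtype.val

/-- The `n`-tuple `(x 1, …, x n)`, with `2 ≤ n`, is reduced with respect to `R₁`, `R₂` and their
common subrelation `R₃`. (Only the values of `x` at `1, …, n` matter.) -/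
structure IsReduced {X : Type*} (R₁ R₂ R₃ : Setoid X) (n : ℕ) (x : ℕ → X) : Prop where
  two_le : 2 ≤ n
  pair : ∀ i : ℕ, 1 ≤ i → i + 1 ≤ n → R₁ (x i) (x (i + 1)) ∨ R₂ (x i) (x (i + 1))
  not_both₁ : ∀ i : ℕ, 1 ≤ i → i + 2 ≤ n →
    ¬ (R₁ (x i) (x (i + 1)) ∧ R₁ (x (i + 1)) (x (i + 2)))
  not_both₂ : ∀ i : ℕ, 1 ≤ i → i + 2 ≤ n →
    ¬ (R₂ (x i) (x (i + 1)) ∧ R₂ (x (i + 1)) (x (i + 2)))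
  not_common : 2 < n → ∀ i : ℕ, 1 ≤ i → i + 1 ≤ n → ¬ R₃ (x i) (x (i + 1))
  ne_of_two : n = 2 → x 1 ≠ x 2

/-- `R` is the amalgamated product of `R₁` and `R₂` over their common subrelation `R₃`:
`R` is generated by `R₁` and `R₂` (it is the smallest equivalence relation containing both),
and no reduced tuple is closed. -/
structure IsAmalgam {X : Type*} (R R₁ R₂ R₃ : Setoid X) : Prop where
  le₁ : R₃ ≤ R₁
  le₂ : R₃ ≤ R₂
  generated : R = R₁ ⊔ R₂
  reduced_not_closed : ∀ (n : ℕ) (x : ℕ → X), IsReduced R₁ R₂ R₃ n x → x n ≠ x 1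

/-- `R` is treeable: there is a Borel graph on `X` (symmetric and off the diagonal) without cycles
whose connected components are exactly the classes of `R`; so every class is given the
structure of a tree. -/
def IsTreeable {X : Type*} [MeasurableSpace X] (R : Setoid X) : Prop :=
  ∃ G : SimpleGraph X, MeasurableSet {p : X × X | G.Adj p.1 p.2} ∧ G.IsAcyclic ∧
    ∀ x y : X, G.Reachable x y ↔ R x y

end BorelRel

/-!
Let `S` act on the first and `Rᵢ` on the second coordinate of the points `(x, y)` of `R`. The
hypothesis says precisely that the relations `S × R₁` and `S × R₂` on `R` are smooth, since `R` is a
countable union of graphs of elements of `[[R]]`, and the absence of closed reduced tuples passes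
from `R₁`, `R₂` to them: `S × R` is their amalgam on `R`. Smoothness makes their quotients standard
Borel, so the Bass–Serre forest of this amalgam, whose vertices are the classes of `S × R₁` and
`S × R₂` and whose edges are the points of `R`, is a Borel graph. Each component of the forest
corresponds to a class of `S × R`. Attach the points of `R` as leaves to their `S × R₁`-classes,
keep only the leaves `(x, x)`, and let every other vertex move step by step to a neighbour nearer to
these leaves. Contracting the basins of the leaves gives a treeing of `S`.
-/

namespace BorelRel

open Set Filter Topology

section LusinNovikov

/-- The values `k` missed by a point that lies in none of these sets would assemble into a choice
function at which covering fails. -/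
theorem exists_mem_iInter_iUnion_choice {X ι : Type*} {κ : ι → Type*}
    {B : (∀ i, κ i) → ι → Set X} (hB : ∀ c x, ∃ i, x ∈ B c i) (x : X) :
    ∃ i, x ∈ ⋂ k, ⋃ c : {c : ∀ i, κ i // c i = k}, B c i := by
  by_contra! hx
  simp only [mem_iInter, not_forall, mem_iUnion, not_exists] at hx
  choose c hc using hx
  obtain ⟨i, hi⟩ := hB c x
  exact hc i ⟨c, rfl⟩ hi

section Splittings

variable {Z : Type*} [MetricSpace Z]

theorem eventually_subset_of_tendsto_ediam_zero {A : ℕ → Set Z}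
    (hA : Tendsto (fun n => Metric.ediam (A n)) atTop (𝓝 0)) {z : Z} (hz : ∀ n, z ∈ A n)
    {O : Set Z} (hO : O ∈ 𝓝 z) : ∀ᶠ n in atTop, A n ⊆ O := by
  obtain ⟨r, hr, hrO⟩ := EMetric.mem_nhds_iff.1 hO
  filter_upwards [hA.eventually (gt_mem_nhds hr)] with n hn w hw
  exact hrO ((Metric.edist_le_ediam_of_mem hw (hz n)).trans_lt hn)

variable [SecondCountableTopology Z]

theorem exists_mem_countableBasis_closure_subset_ediam_le {z : Z} {O : Set Z} (hO : IsOpen O)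
    (hz : z ∈ O) {ε : ENNReal} (hε : 0 < ε) :
    ∃ V ∈ TopologicalSpace.countableBasis Z, z ∈ V ∧ closure V ⊆ O ∧ Metric.ediam V ≤ ε := by
  have hball : O ∩ Metric.eball z (ε / 2) ∈ 𝓝 z :=
    inter_mem (hO.mem_nhds hz) (Metric.eball_mem_nhds z (ENNReal.half_pos hε.ne'))
  obtain ⟨V, hV, hzV, hVO⟩ :=
    (TopologicalSpace.isBasis_countableBasis Z).exists_closure_subset hball
  refine ⟨V, hV, hzV, hVO.trans inter_subset_left, ?_⟩
  calc Metric.ediam V ≤ Metric.ediam (Metric.eball z (ε / 2)) :=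
        Metric.ediam_mono (subset_closure.trans (hVO.trans inter_subset_right))
    _ ≤ 2 * (ε / 2) := Metric.ediam_eball_le
    _ = ε := ENNReal.mul_div_cancel (by simp) (by simp)

/-- The disjoint pairs of basic open sets of diameter at most `ε` whose closures lie in `W`: the
ways in which a node of a Cantor scheme may branch. -/
def splittings (W : Set Z) (ε : ENNReal) : Set (Bool → Set Z) :=
  {U | (∀ b, U b ∈ TopologicalSpace.countableBasis Z) ∧ (∀ b, closure (U b) ⊆ W) ∧
    (∀ b, Metric.ediam (U b) ≤ ε) ∧ Disjoint (U true) (U false)}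

theorem countable_splittings (W : Set Z) (ε : ENNReal) :
    (splittings W ε).Countable :=
  (countable_pi fun _ => TopologicalSpace.countable_countableBasis Z).mono fun _ hU => hU.1

theorem exists_mem_splittings {W : Set Z} (hW : IsOpen W) {ε : ENNReal} (hε : 0 < ε) {z z' : Z}
    (hz : z ∈ W) (hz' : z' ∈ W) (hne : z ≠ z') :
    ∃ U ∈ splittings W ε, z ∈ U true ∧ z' ∈ U false := by
  obtain ⟨O, O', hO, hO', hzO, hzO', hdisj⟩ := t2_separation hne
  obtain ⟨V, hV, hzV, hVO, hVε⟩ := exists_mem_countableBasis_closure_subset_ediam_le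
    (hW.inter hO) ⟨hz, hzO⟩ hε
  obtain ⟨V', hV', hzV', hVO', hVε'⟩ := exists_mem_countableBasis_closure_subset_ediam_le
    (hW.inter hO') ⟨hz', hzO'⟩ hε
  refine ⟨fun b => bif b then V else V', ⟨Bool.forall_bool.2 ⟨hV', hV⟩, Bool.forall_bool.2
    ⟨hVO'.trans inter_subset_left, hVO.trans inter_subset_left⟩, Bool.forall_bool.2 ⟨hVε', hVε⟩,
    hdisj.mono ?_ ?_⟩, hzV, hzV'⟩
  exacts [subset_closure.trans (hVO.trans inter_subset_right),
    subset_closure.trans (hVO'.trans inter_subset_right)]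

theorem vanishingDiam_of_splittings {A : List Bool → Set Z}
    (hA : ∀ l, (fun b => A (b :: l)) ∈ splittings (A l) (2⁻¹ ^ l.length)) :
    CantorScheme.VanishingDiam A := by
  intro a
  rw [← tendsto_add_atTop_iff_nat 1]
  refine tendsto_of_tendsto_of_tendsto_of_le_of_le tendsto_const_nhds
    (ENNReal.tendsto_pow_atTop_nhds_zero_of_lt_one (r := 2⁻¹) (by simp)) (fun _ => zero_le)
    fun n => ?_
  have h := (hA (PiNat.res a n)).2.2.1 (a n)
  rwa [PiNat.res_length] at h

theorem exists_injective_mem_res_of_splittings [CompleteSpace Z] {A : List Bool → Set Z}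
    (hA : ∀ l, (fun b => A (b :: l)) ∈ splittings (A l) (2⁻¹ ^ l.length))
    (hne : ∀ l, (A l).Nonempty) :
    ∃ ζ : (ℕ → Bool) → Z, ζ.Injective ∧ ∀ a n, ζ a ∈ A (PiNat.res a n) := by
  have hdisj : CantorScheme.Disjoint A := by
    intro l
    have h := (hA l).2.2.2
    rintro (_ | _) (_ | _) hne
    exacts [(hne rfl).elim, h.symm, h, (hne rfl).elim]
  have hdom := CantorScheme.ClosureAntitone.map_of_vanishingDiam (vanishingDiam_of_splittings hA)
    (fun l b => (hA l).2.1 b) hne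
  exact ⟨fun a => (CantorScheme.inducedMap A).2 ⟨a, hdom ▸ mem_univ a⟩,
    fun a b h => congrArg Subtype.val (hdisj.map_injective h),
    fun a n => CantorScheme.map_mem _ n⟩

end Splittings

variable {Z X : Type*} [MeasurableSpace Z]

/-- The set `A` is covered by countably many Borel sets on which `π` is injective. This is the
conclusion of the Lusin–Novikov theorem for maps with countable fibres. -/
def IsSigmaInjOn (π : Z → X) (A : Set Z) : Prop :=
  ∃ 𝒜 : Set (Set Z), 𝒜.Countable ∧ (∀ P ∈ 𝒜, MeasurableSet P ∧ InjOn π P) ∧ A ⊆ ⋃₀ 𝒜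

theorem IsSigmaInjOn.mono {π : Z → X} {A B : Set Z} (hB : IsSigmaInjOn π B) (h : A ⊆ B) :
    IsSigmaInjOn π A := by
  obtain ⟨𝒜, hc, hinj, hcov⟩ := hB
  exact ⟨𝒜, hc, hinj, h.trans hcov⟩

theorem IsSigmaInjOn.of_injOn {π : Z → X} {A : Set Z} (hA : MeasurableSet A) (h : InjOn π A) :
    IsSigmaInjOn π A :=
  ⟨{A}, countable_singleton A, by simpa using ⟨hA, h⟩, by simp⟩

theorem IsSigmaInjOn.iUnion {π : Z → X} {ι : Type*} [Countable ι] {A : ι → Set Z}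
    (h : ∀ i, IsSigmaInjOn π (A i)) : IsSigmaInjOn π (⋃ i, A i) := by
  choose 𝒜 hc hinj hcov using h
  refine ⟨⋃ i, 𝒜 i, countable_iUnion hc, fun P hP => ?_, iUnion_subset fun i =>
    (hcov i).trans (sUnion_subset_sUnion (subset_iUnion 𝒜 i))⟩
  obtain ⟨i, hi⟩ := mem_iUnion.1 hP
  exact hinj i P hi

theorem IsSigmaInjOn.union {π : Z → X} {A B : Set Z} (hA : IsSigmaInjOn π A)
    (hB : IsSigmaInjOn π B) : IsSigmaInjOn π (A ∪ B) := by
  rw [union_eq_iUnion]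
  exact .iUnion fun b => by cases b <;> assumption

variable [MeasurableSpace X]

/-- The family `A` is separated by `π`: there are Borel sets `B i` covering `X` such that, for each
`i`, the part of `A i` over `B i` is `IsSigmaInjOn`. Non-separated families are the large ones in
the construction of a Cantor set inside a fibre of `π`. -/
def IsSeparated (π : Z → X) {ι : Type*} (A : ι → Set Z) : Prop :=
  ∃ B : ι → Set X, (∀ i, MeasurableSet (B i)) ∧ (∀ x, ∃ i, x ∈ B i) ∧
    ∀ i, IsSigmaInjOn π (A i ∩ π ⁻¹' B i)

theorem IsSeparated.comp_surjective {π : Z → X} {ι κ : Type*} {A : ι → Set Z}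
    (hA : IsSeparated π A) {f : κ → ι} (hf : f.Surjective) : IsSeparated π (A ∘ f) := by
  obtain ⟨B, hB, hcov, hinj⟩ := hA
  refine ⟨B ∘ f, fun k => hB _, fun x => ?_, fun k => hinj _⟩
  obtain ⟨i, hi⟩ := hcov x
  obtain ⟨k, rfl⟩ := hf i
  exact ⟨k, hi⟩

theorem IsSigmaInjOn.isSeparated {π : Z → X} {ι : Type*} {A : ι → Set Z} {i : ι}
    (hA : IsSigmaInjOn π (A i)) : IsSeparated π A := by
  refine ⟨fun k => {_x | k = i}, fun k => .const _, fun x => ⟨i, rfl⟩, fun k => hA.mono ?_⟩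
  rintro z ⟨hz, rfl⟩
  exact hz

theorem nonempty_of_not_isSeparated {π : Z → X} {ι : Type*} {A : ι → Set Z}
    (hA : ¬ IsSeparated π A) (i : ι) : (A i).Nonempty := by
  contrapose! hA
  exact IsSigmaInjOn.isSeparated (i := i) (hA ▸ .of_injOn .empty (injOn_empty π))

theorem isSeparated_of_subset_preimage {π : Z → X} {ι : Type*} {A : ι → Set Z} {i j : ι}
    {B : Set X} (hB : MeasurableSet B) (hi : A i ⊆ π ⁻¹' B) (hj : A j ⊆ π ⁻¹' Bᶜ) :
    IsSeparated π A := by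
  refine ⟨fun k => {x | k = i ∧ x ∉ B} ∪ {x | k = j ∧ x ∈ B}, fun k => ?_, fun x => ?_,
    fun k => ?_⟩
  · exact ((MeasurableSet.const _).inter hB.compl).union ((MeasurableSet.const _).inter hB)
  · by_cases hx : x ∈ B
    exacts [⟨j, .inr ⟨rfl, hx⟩⟩, ⟨i, .inl ⟨rfl, hx⟩⟩]
  · refine (IsSigmaInjOn.of_injOn .empty (injOn_empty π)).mono ?_
    rintro z ⟨hz, ⟨rfl, hzB⟩ | ⟨rfl, hzB⟩⟩
    exacts [hzB (hi hz), hj hz hzB]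

/-- The key step of the Cantor scheme. If every simultaneous splitting of the `W i` were separated,
then diagonalising over the countably many splittings would separate the `W i`: a fibre with two
points in `W i` would meet both halves of some splitting of `W i`. -/
theorem exists_splittings_not_isSeparated [MetricSpace Z] [SecondCountableTopology Z]
    [OpensMeasurableSpace Z] {π : Z → X} (hπ : Measurable π) {ι : Type*} [Finite ι]
    {W : ι → Set Z} (hW : ∀ i, IsOpen (W i)) (hsep : ¬ IsSeparated π W) {ε : ENNReal}
    (hε : 0 < ε) : ∃ U : ι → Bool → Set Z, (∀ i, U i ∈ splittings (W i) ε) ∧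
      ¬ IsSeparated π fun p : ι × Bool => U p.1 p.2 := by
  by_contra! hcon
  have (i : ι) : Countable (splittings (W i) ε) := (countable_splittings (W i) ε).to_subtype
  choose B hB hcov hinj using fun c : ∀ i, splittings (W i) ε =>
    hcon (fun i => c i) fun i => (c i).2
  have hcov' (c) (x : X) : ∃ i, x ∈ ⋃ b, B c (i, b) :=
    let ⟨(i, b), hx⟩ := hcov c x
    ⟨i, mem_iUnion.2 ⟨b, hx⟩⟩
  let C : ι → Set X := fun i =>
    ⋂ k, ⋃ c : {c : ∀ i, splittings (W i) ε // c i = k}, ⋃ b, B c (i, b)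
  have hC (i : ι) : MeasurableSet (C i) :=
    .iInter fun k => .iUnion fun c => .iUnion fun b => hB c (i, b)
  refine hsep ⟨C, hC, exists_mem_iInter_iUnion_choice hcov', fun i => ?_⟩
  let N : Set Z := ⋃ c, ⋃ b, (c i).1 b ∩ π ⁻¹' B c (i, b)
  have hN : MeasurableSet N := .iUnion fun c => .iUnion fun b =>
    (TopologicalSpace.isOpen_of_mem_countableBasis ((c i).2.1 b)).measurableSet.inter
      (hπ (hB c (i, b)))
  have hNinj : IsSigmaInjOn π N := .iUnion fun c => .iUnion fun b => hinj c (i, b)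
  have hrest : InjOn π ((W i ∩ π ⁻¹' C i) \ N) := by
    rintro z ⟨⟨hzW, hzC⟩, hzN⟩ z' ⟨⟨hzW', -⟩, hzN'⟩ hzz'
    by_contra hne
    obtain ⟨U, hU, hzU, hzU'⟩ := exists_mem_splittings (hW i) hε hzW hzW' hne
    obtain ⟨⟨c, hc⟩, hx⟩ := mem_iUnion.1 (mem_iInter.1 hzC ⟨U, hU⟩)
    obtain ⟨b, hb⟩ := mem_iUnion.1 hx
    simp only [N, mem_iUnion, not_exists] at hzN hzN'
    cases b
    · exact hzN' c false ⟨by rwa [hc], by rwa [mem_preimage, ← hzz']⟩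
    · exact hzN c true ⟨by rwa [hc], hb⟩
  have hrest_meas : MeasurableSet ((W i ∩ π ⁻¹' C i) \ N) :=
    ((hW i).measurableSet.inter (hπ (hC i))).diff hN
  exact ((IsSigmaInjOn.of_injOn hrest_meas hrest).union hNinj).mono
    (subset_sdiff_union _ _)

theorem exists_cantorScheme_not_isSeparated [MetricSpace Z] [SecondCountableTopology Z]
    [OpensMeasurableSpace Z] {π : Z → X} (hπ : Measurable π) (hinj : ¬ IsSigmaInjOn π univ) :
    ∃ A : List Bool → Set Z, (∀ l, (fun b => A (b :: l)) ∈ splittings (A l) (2⁻¹ ^ l.length)) ∧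
      ∀ n, ¬ IsSeparated π fun l : List.Vector Bool n => A l.1 := by
  let Level (n : ℕ) : Type _ :=
    {V : List.Vector Bool n → Set Z // (∀ l, IsOpen (V l)) ∧ ¬ IsSeparated π V}
  have branch (n : ℕ) (V : Level n) : ∃ V' : Level (n + 1),
      ∀ l, (fun b => V'.1 (b ::ᵥ l)) ∈ splittings (V.1 l) (2⁻¹ ^ n) := by
    obtain ⟨V, hVo, hVsep⟩ := V
    obtain ⟨U, hU, hUsep⟩ := exists_splittings_not_isSeparated hπ hVo hVsep
      (ENNReal.pow_pos (show (0 : ENNReal) < 2⁻¹ by simp) n)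
    refine ⟨⟨fun l => U l.tail l.head, fun l =>
      TopologicalSpace.isOpen_of_mem_countableBasis ((hU _).1 _), fun h => hUsep ?_⟩,
      by simpa using hU⟩
    have cons_surjective : (fun p : List.Vector Bool n × Bool => p.2 ::ᵥ p.1).Surjective :=
      fun l => ⟨(l.tail, l.head), l.cons_head_tail⟩
    simpa [Function.comp_def] using h.comp_surjective cons_surjective
  have root : ¬ IsSeparated π fun _ : List.Vector Bool 0 => (univ : Set Z) := by
    rintro ⟨B, -, hcov, hB⟩
    refine hinj ((IsSigmaInjOn.iUnion hB).mono fun z _ => ?_)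
    simpa using hcov (π z)
  choose next hnext using branch
  let level (n : ℕ) : Level n := n.rec ⟨fun _ => univ, fun _ => isOpen_univ, root⟩ next
  refine ⟨fun l => (level l.length).1 ⟨l, rfl⟩, fun l => hnext _ (level l.length) ⟨l, rfl⟩,
    fun n => ?_⟩
  have level_eq : (fun l : List.Vector Bool n => (level l.1.length).1 ⟨l.1, rfl⟩) =
      (level n).1 := by
    ext1 ⟨l, hl⟩
    subst hl
    rfl
  exact level_eq ▸ (level n).2.2

theorem exists_not_countable_fiber [MetricSpace Z] [CompleteSpace Z] [SecondCountableTopology Z]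
    [BorelSpace Z] [TopologicalSpace X] [T2Space X] [BorelSpace X] {π : Z → X}
    (hπ : Continuous π) (hinj : ¬ IsSigmaInjOn π univ) : ∃ x, ¬ (π ⁻¹' {x}).Countable := by
  obtain ⟨A, hA, hsep⟩ := exists_cantorScheme_not_isSeparated hπ.measurable hinj
  obtain ⟨ζ, hζ, hζA⟩ := exists_injective_mem_res_of_splittings hA fun l =>
    nonempty_of_not_isSeparated (hsep l.length) ⟨l, rfl⟩
  have same_fiber (a b : ℕ → Bool) : π (ζ a) = π (ζ b) := by
    by_contra hab
    obtain ⟨O, O', hO, hO', haO, hbO', hdisj⟩ := t2_separation hab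
    have eventually_over {a : ℕ → Bool} {O : Set X} (hO : IsOpen O) (ha : π (ζ a) ∈ O) :
        ∀ᶠ n in atTop, A (PiNat.res a n) ⊆ π ⁻¹' O :=
      eventually_subset_of_tendsto_ediam_zero (vanishingDiam_of_splittings hA a) (hζA a)
        ((hO.preimage hπ).mem_nhds ha)
    obtain ⟨n, ha, hb⟩ := ((eventually_over hO haO).and (eventually_over hO' hbO')).exists
    exact hsep n (isSeparated_of_subset_preimage (i := ⟨_, PiNat.res_length a n⟩)
      (j := ⟨_, PiNat.res_length b n⟩) hO.measurableSet ha
      (hb.trans (preimage_mono hdisj.subset_compl_left)))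
  have : Uncountable (ℕ → Bool) := by
    simpa [← Cardinal.aleph0_lt_mk_iff] using Cardinal.aleph0_lt_continuum
  exact ⟨π (ζ fun _ => true), fun hcount => not_countable_univ <|
    (hcount.preimage_of_injOn hζ.injOn).mono fun a _ => same_fiber a _⟩

theorem isSigmaInjOn_univ_of_countable_fibers [StandardBorelSpace Z] [StandardBorelSpace X]
    {π : Z → X} (hπ : Measurable π) (hc : ∀ x, (π ⁻¹' {x}).Countable) :
    IsSigmaInjOn π univ := by
  let := upgradeStandardBorel X
  obtain ⟨t₀, hborel₀, hpolish₀⟩ := StandardBorelSpace.polish (α := Z)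
  obtain ⟨t, ht, hcont, hpolish⟩ := hπ.exists_continuous
  have hborel : @BorelSpace Z t _ := @BorelSpace.mk Z t _
    (hborel₀.measurable_eq.trans (MeasureTheory.borel_eq_borel_of_le hpolish hpolish₀ ht).symm)
  by_contra hinj
  let := @TopologicalSpace.upgradeIsCompletelyMetrizable Z t _
  obtain ⟨x, hx⟩ := exists_not_countable_fiber hcont hinj
  exact hx (hc x)

theorem IsSigmaInjOn.exists_measurable_seq [StandardBorelSpace Z]
    [MeasurableSpace.CountablySeparated X] {Y : Type*} [MeasurableSpace Y] [Nonempty Y]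
    {π : Z → X} (hπ : Measurable π) (hinj : IsSigmaInjOn π univ) {g : Z → Y}
    (hg : Measurable g) :
    ∃ f : ℕ → X → Y, (∀ n, Measurable (f n)) ∧ ∀ z, ∃ n, f n (π z) = g z := by
  obtain ⟨𝒜, hc, h𝒜, hcov⟩ := hinj
  obtain ⟨Q, hQ⟩ := (hc.insert ∅).exists_eq_range (insert_nonempty _ _)
  have extend (n : ℕ) : ∃ f : X → Y, Measurable f ∧ ∀ z ∈ Q n, f (π z) = g z := by
    have hQn : MeasurableSet (Q n) ∧ InjOn π (Q n) := by
      obtain hn | hn : Q n ∈ insert ∅ 𝒜 := hQ ▸ mem_range_self n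
      · exact hn ▸ ⟨.empty, injOn_empty π⟩
      · exact h𝒜 _ hn
    have := hQn.1.standardBorel
    obtain ⟨f, hf, hfg⟩ := ((hπ.comp measurable_subtype_coe).measurableEmbedding
      (injOn_iff_injective.1 hQn.2)).exists_measurable_extend
      (hg.comp measurable_subtype_coe) fun _ => ‹_›
    exact ⟨f, hf, fun z hz => congrFun hfg ⟨z, hz⟩⟩
  choose f hf hfg using extend
  refine ⟨f, hf, fun z => ?_⟩
  obtain ⟨A, hA, hzA⟩ := hcov (mem_univ z)
  obtain ⟨n, rfl⟩ : A ∈ range Q := hQ ▸ mem_insert_of_mem _ hA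
  exact ⟨n, hfg n z hzA⟩

/-- The **Lusin–Novikov theorem**. -/
theorem exists_measurable_seq_of_countable_sections {Y : Type*} [MeasurableSpace Y]
    [StandardBorelSpace X] [StandardBorelSpace Y] [Nonempty Y] {P : Set (X × Y)}
    (hP : MeasurableSet P) (hc : ∀ x, {y | (x, y) ∈ P}.Countable) :
    ∃ f : ℕ → X → Y, (∀ n, Measurable (f n)) ∧ ∀ x y, (x, y) ∈ P → ∃ n, f n x = y := by
  have := hP.standardBorel
  have hfst : Measurable fun p : P => p.1.1 := measurable_fst.comp measurable_subtype_coe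
  have hfib (x : X) : ((fun p : P => p.1.1) ⁻¹' {x}).Countable := by
    refine MapsTo.countable_of_injOn (f := fun p : P => p.1.2) ?_ ?_ (hc x)
    · rintro ⟨⟨_, y⟩, hy⟩ rfl
      exact hy
    · rintro ⟨⟨_, y⟩, hy⟩ rfl ⟨⟨_, y'⟩, hy'⟩ hx heq
      exact Subtype.ext (Prod.ext hx.symm heq)
  obtain ⟨f, hf, hfP⟩ := (isSigmaInjOn_univ_of_countable_fibers hfst hfib).exists_measurable_seq
    hfst (measurable_snd.comp measurable_subtype_coe)
  exact ⟨f, hf, fun x y hxy => hfP ⟨(x, y), hxy⟩⟩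

theorem measurableSet_exists_mem_of_countable_sections {Y : Type*} [MeasurableSpace Y]
    [StandardBorelSpace X] [StandardBorelSpace Y] {P : Set (X × Y)}
    (hP : MeasurableSet P) (hc : ∀ x, {y | (x, y) ∈ P}.Countable) :
    MeasurableSet {x | ∃ y, (x, y) ∈ P} := by
  cases isEmpty_or_nonempty Y
  · simp
  obtain ⟨f, hf, hfP⟩ := exists_measurable_seq_of_countable_sections hP hc
  have heq : {x | ∃ y, (x, y) ∈ P} = ⋃ n, {x | (x, f n x) ∈ P} := by
    ext x
    refine ⟨fun ⟨y, hxy⟩ => ?_, fun hx => ?_⟩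
    · obtain ⟨n, rfl⟩ := hfP x y hxy
      exact mem_iUnion.2 ⟨n, hxy⟩
    · obtain ⟨n, hn⟩ := mem_iUnion.1 hx
      exact ⟨_, hn⟩
  exact heq ▸ .iUnion fun n => (measurable_id.prodMk (hf n)) hP

theorem exists_measurable_uniformization {Y : Type*} [MeasurableSpace Y]
    [StandardBorelSpace X] [StandardBorelSpace Y] {P : Set (X × Y)}
    (hP : MeasurableSet P) (hc : ∀ x, {y | (x, y) ∈ P}.Countable) (hne : ∀ x, ∃ y, (x, y) ∈ P) :
    ∃ F : X → Y, Measurable F ∧ ∀ x, (x, F x) ∈ P := by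
  classical
  cases isEmpty_or_nonempty X
  · exact ⟨isEmptyElim, measurable_of_empty _, isEmptyElim⟩
  have : Nonempty Y := (hne (Classical.arbitrary X)).nonempty
  obtain ⟨f, hf, hfP⟩ := exists_measurable_seq_of_countable_sections hP hc
  have hex (x : X) : ∃ n, (x, f n x) ∈ P := by
    obtain ⟨y, hxy⟩ := hne x
    obtain ⟨n, rfl⟩ := hfP x y hxy
    exact ⟨n, hxy⟩
  exact ⟨fun x => f (Nat.find (hex x)) x,
    Measurable.find hf (fun n => (measurable_id.prodMk (hf n)) hP) hex,
    fun x => Nat.find_spec (hex x)⟩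

end LusinNovikov

section Smooth

theorem HasCountableClasses.mono {X : Type*} {E F : Setoid X} (hF : HasCountableClasses F)
    (h : E ≤ F) : HasCountableClasses E :=
  fun x => (hF x).mono fun _ hxy => h hxy

theorem HasCountableClasses.prod {X Y : Type*} {E : Setoid X} {F : Setoid Y}
    (hE : HasCountableClasses E) (hF : HasCountableClasses F) : HasCountableClasses (E.prod F) :=
  fun p => (hE p.1).prod (hF p.2)

theorem HasCountableClasses.restrict {X : Type*} {E : Setoid X} (hE : HasCountableClasses E)
    (A : Set X) : HasCountableClasses (restrict E A) :=
  fun x => (hE x).preimage Subtype.val_injective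

theorem restrict_prod_le {X : Type*} {R S Q : Setoid X} (hSR : S ≤ R) :
    restrict (S.prod Q) {p | R p.1 p.2} ≤ restrict (R.prod R) {p | R p.1 p.2} :=
  fun {p q} h => ⟨hSR h.1, R.trans (R.symm p.2) (R.trans (hSR h.1) q.2)⟩

theorem IsBorel.prod {X Y : Type*} [MeasurableSpace X] [MeasurableSpace Y] {E : Setoid X}
    {F : Setoid Y} (hE : IsBorel E) (hF : IsBorel F) : IsBorel (E.prod F) :=
  (((measurable_fst.comp measurable_fst).prodMk (measurable_fst.comp measurable_snd)) hE).inter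
    (((measurable_snd.comp measurable_fst).prodMk (measurable_snd.comp measurable_snd)) hF)

theorem IsBorel.restrict {X : Type*} [MeasurableSpace X] {E : Setoid X} (hE : IsBorel E)
    (A : Set X) : IsBorel (restrict E A) :=
  ((measurable_subtype_coe.comp measurable_fst).prodMk
    (measurable_subtype_coe.comp measurable_snd)) hE

theorem isSmooth_of_partial_transversals {X : Type*} [MeasurableSpace X] [StandardBorelSpace X]
    {E : Setoid X} (hE : IsBorel E) (hc : HasCountableClasses E) {T : ℕ → Set X}
    (hT : ∀ n, MeasurableSet (T n)) (hpart : ∀ n, ∀ x ∈ T n, ∀ y ∈ T n, E x y → x = y)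
    (hcov : ∀ x, ∃ n, ∃ y, E x y ∧ y ∈ T n) : IsSmooth E := by
  classical
  have saturation (n : ℕ) : MeasurableSet {x | ∃ y, E x y ∧ y ∈ T n} :=
    measurableSet_exists_mem_of_countable_sections (hE.inter (measurable_snd (hT n)))
      fun x => (hc x).mono fun _ hy => hy.1
  refine ⟨⋃ n, T n ∩ ⋂ m < n, {x | ∃ y, E x y ∧ y ∈ T m}ᶜ, .iUnion fun n => (hT n).inter <|
    .iInter fun m => .iInter fun _ => (saturation m).compl, fun x => ?_⟩
  obtain ⟨y, hxy, hy⟩ := Nat.find_spec (hcov x)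
  simp only [mem_iUnion, mem_inter_iff, mem_iInter, mem_compl_iff, mem_ofPred_eq, not_exists,
    not_and]
  refine ⟨y, ⟨⟨_, hy, fun m hm z hyz hz => Nat.find_min (hcov x) hm ⟨z, E.trans hxy hyz, hz⟩⟩,
    hxy⟩, ?_⟩
  rintro y' ⟨⟨n, hy', hmin⟩, hxy'⟩
  have hn : n = Nat.find (hcov x) := le_antisymm
    (not_lt.1 fun h => hmin _ h y (E.trans (E.symm hxy') hxy) hy)
    (Nat.find_min' (hcov x) ⟨y', hxy', hy'⟩)
  exact hpart _ y' (hn ▸ hy') y hy (E.trans (E.symm hxy') hxy)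

/-- The map `c` picks a point of each class of `E`: it sends every point to the chosen point of
its class. -/
structure IsSelector {X : Type*} (E : Setoid X) (c : X → X) : Prop where
  rel (x : X) : E x (c x)
  eq_of_rel {x y : X} (h : E x y) : c x = c y

theorem IsSelector.eq_iff {X : Type*} {E : Setoid X} {c : X → X} (hc : IsSelector E c) {x y : X} :
    c x = c y ↔ E x y :=
  ⟨fun h => E.trans (hc.rel x) (h ▸ E.symm (hc.rel y)), hc.eq_of_rel⟩

theorem IsSmooth.exists_isSelector {X : Type*} [MeasurableSpace X] [StandardBorelSpace X]
    {E : Setoid X} (hE : IsBorel E) (hs : IsSmooth E) :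
    ∃ c : X → X, Measurable c ∧ IsSelector E c := by
  obtain ⟨D, hD, hDE⟩ := hs
  have hP : MeasurableSet {p : X × X | p.2 ∈ D ∧ E p.1 p.2} := (measurable_snd hD).inter hE
  obtain ⟨c, hc, hcD⟩ := exists_measurable_uniformization hP
    (fun x => Subsingleton.countable fun _ hy _ hz => (hDE x).unique hy hz)
    fun x => (hDE x).exists
  exact ⟨c, hc, fun x => (hcD x).2, fun {x y} h =>
    (hDE y).unique ⟨(hcD x).1, E.trans (E.symm h) (hcD x).2⟩ (hcD y)⟩

/-- The element of the full pseudogroup of `R` with rule `f` and inverse `g`, defined wherever these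
rules make sense. -/
def pseudogroupElement {X : Type*} (R : Setoid X) (f g : X → X) : PartialEquiv X X where
  toFun := f
  invFun := g
  source := {x | R x (f x) ∧ g (f x) = x}
  target := {y | R y (g y) ∧ f (g y) = y}
  map_source' := by
    rintro x ⟨hx, hgf⟩
    exact ⟨by simpa only [hgf] using R.symm hx, by rw [hgf]⟩
  map_target' := by
    rintro y ⟨hy, hfg⟩
    exact ⟨by simpa only [hfg] using R.symm hy, by rw [hfg]⟩
  left_inv' _ hx := hx.2
  right_inv' _ hy := hy.2

theorem memFullPseudogroup_pseudogroupElement {X : Type*} [MeasurableSpace X]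
    [StandardBorelSpace X] {R : Setoid X} (hR : IsBorel R) {f g : X → X} (hf : Measurable f)
    (hg : Measurable g) : MemFullPseudogroup R (pseudogroupElement R f g) where
  measurableSet_source := ((measurable_id.prodMk hf) hR).inter
    (measurableSet_eq_fun (hg.comp hf) measurable_id)
  measurableSet_target := ((measurable_id.prodMk hg) hR).inter
    (measurableSet_eq_fun (hf.comp hg) measurable_id)
  measurable_toFun := hf.comp measurable_subtype_coe
  measurable_invFun := hg.comp measurable_subtype_coe
  graph_subset _ hx := hx.1

/-- By Lusin–Novikov, `R` is covered by countably many graphs of elements of its full pseudogroup;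
over each of them the relation is a copy of some `φ⁻¹ Q φ ∩ S`. -/
theorem isSmooth_restrict_prod {X : Type*} [MeasurableSpace X] [StandardBorelSpace X]
    {R S Q : Setoid X} (hR : IsBorel R) (hRc : HasCountableClasses R) (hS : IsBorel S)
    (hSR : S ≤ R) (hQ : IsBorel Q)
    (hsmooth : ∀ φ : PartialEquiv X X, MemFullPseudogroup R φ →
      IsSmooth (conj φ Q ⊓ restrict S φ.source)) :
    IsSmooth (restrict (S.prod Q) {p | R p.1 p.2}) := by
  cases isEmpty_or_nonempty X
  · exact ⟨∅, .empty, fun p => isEmptyElim p.1.1⟩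
  obtain ⟨f, hf, hfR⟩ := exists_measurable_seq_of_countable_sections hR hRc
  let φ (n m : ℕ) : PartialEquiv X X := pseudogroupElement R (f n) (f m)
  have hφ (n m : ℕ) : MemFullPseudogroup R (φ n m) :=
    memFullPseudogroup_pseudogroupElement hR (hf n) (hf m)
  choose D hD hDS using fun n m => hsmooth (φ n m) (hφ n m)
  have := MeasurableSet.standardBorel hR
  refine isSmooth_of_partial_transversals ((hS.prod hQ).restrict _)
    (((hRc.prod hRc).restrict _).mono (restrict_prod_le hSR))
    (T := fun k => {p | p.1.1 ∈ Subtype.val '' D k.unpair.1 k.unpair.2 ∧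
      p.1.2 = f k.unpair.1 p.1.1}) (fun k => ?_) ?_ ?_
  · have hfst : Measurable fun p : {p : X × X | R p.1 p.2} => p.1.1 :=
      measurable_fst.comp measurable_subtype_coe
    exact (hfst ((hφ _ _).measurableSet_source.subtype_image (hD _ _))).inter
      (measurableSet_eq_fun (measurable_snd.comp measurable_subtype_coe) ((hf _).comp hfst))
  · rintro k ⟨⟨_, y⟩, _⟩ ⟨⟨d, hd, rfl⟩, (rfl : y = f _ d)⟩ ⟨⟨_, y'⟩, _⟩
      ⟨⟨d', hd', rfl⟩, (rfl : y' = f _ d')⟩ ⟨hS, hQ⟩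
    obtain rfl := (hDS _ _ d).unique ⟨hd, (conj _ Q ⊓ restrict S _).refl _⟩ ⟨hd', hQ, hS⟩
    rfl
  · rintro ⟨⟨x, y⟩, hxy⟩
    obtain ⟨n, rfl⟩ := hfR x y hxy
    obtain ⟨m, hm⟩ := hfR _ _ (R.symm hxy)
    obtain ⟨d, ⟨hd, hQd, hSd⟩, -⟩ := hDS n m ⟨x, hxy, hm⟩
    refine ⟨Nat.pair n m, ⟨(d, f n d), d.2.1⟩, ⟨hSd, hQd⟩, ?_⟩
    rw [mem_ofPred_eq, Nat.unpair_pair]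
    exact ⟨⟨d, hd, rfl⟩, rfl⟩

end Smooth

section CosetGraph

theorem exists_nonbacktracking_of_isCycle {V : Type*} {G : SimpleGraph V} {v : V} {c : G.Walk v v}
    (hc : c.IsCycle) :
    ∃ (n : ℕ) (w : ℕ → V), 3 ≤ n ∧ (∀ k, w (k + n) = w k) ∧ (∀ k, G.Adj (w k) (w (k + 1))) ∧
      ∀ k, w k ≠ w (k + 2) := by
  have hn : 3 ≤ c.length := hc.three_le_length
  refine ⟨c.length, fun k => c.getVert (k % c.length), hn, by simp, fun k => ?_, fun k h => ?_⟩
  · have hk : k % c.length < c.length := Nat.mod_lt k (by omega)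
    beta_reduce
    have hadj := c.adj_getVert_succ hk
    rcases Nat.lt_or_ge (k % c.length + 1) c.length with h | h
    · rwa [Nat.add_mod, Nat.mod_eq_of_lt (show 1 < c.length by omega), Nat.mod_eq_of_lt h]
    · have heq : k % c.length + 1 = c.length := by omega
      rw [heq, c.getVert_length] at hadj
      rwa [Nat.add_mod, Nat.mod_eq_of_lt (show 1 < c.length by omega), heq, Nat.mod_self,
        c.getVert_zero]
  · have hk : k % c.length < c.length := Nat.mod_lt k (by omega)
    have hk' : (k + 2) % c.length < c.length := Nat.mod_lt _ (by omega)
    have heq := hc.getVert_injOn' (show k % c.length ≤ c.length - 1 by omega)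
      (show (k + 2) % c.length ≤ c.length - 1 by omega) h
    have hdvd := (Nat.modEq_iff_dvd' (by omega)).1 heq
    have := Nat.le_of_dvd (by omega) hdvd
    omega

/-- The graph of cosets of a family of equivalence relations on `P`, given by selectors `c i`: its
vertices of type `i` are the points `c i p`, standing for the classes of the `i`-th relation, and
two vertices whose types are adjacent in `L` are joined when the classes intersect. The pairs
`(i, q)` with `q` not in the range of `c i` are isolated. -/
def cosetGraph {ι P : Type*} (L : SimpleGraph ι) (c : ι → P → P) : SimpleGraph (ι × P) where
  Adj v w := L.Adj v.1 w.1 ∧ ∃ p, c v.1 p = v.2 ∧ c w.1 p = w.2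
  symm := ⟨fun _ _ ⟨hL, p, hv, hw⟩ => ⟨hL.symm, p, hw, hv⟩⟩
  loopless := ⟨fun _ h => h.1.ne rfl⟩

/-- The `k`-th vertex of the cycle has type `t k`, and `x k` is a point common to the `k`-th and the
`(k + 1)`-st coset. -/
theorem exists_closed_seq_of_isCycle_cosetGraph {ι P : Type*} {L : SimpleGraph ι} {E : ι → Setoid P}
    {c : ι → P → P} (hc : ∀ i, IsSelector (E i) (c i)) {v : ι × P}
    {walk : (cosetGraph L c).Walk v v} (hcycle : walk.IsCycle) :
    ∃ (n : ℕ) (t : ℕ → ι) (x : ℕ → P), 3 ≤ n ∧ (∀ k, x (k + n) = x k) ∧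
      (∀ k, L.Adj (t k) (t (k + 1))) ∧ (∀ k, E (t (k + 1)) (x k) (x (k + 1))) ∧
      ∀ k, t k = t (k + 2) → ¬ E (t k) (x k) (x (k + 1)) := by
  obtain ⟨n, w, hn, hper, hadj, hne⟩ := exists_nonbacktracking_of_isCycle hcycle
  have : Nonempty P := (hadj 0).2.nonempty
  choose! common hleft hright using fun (v v' : ι × P) (h : (cosetGraph L c).Adj v v') => h.2
  refine ⟨n, fun k => (w k).1, fun k => common (w k) (w (k + 1)), hn, fun k => ?_,
    fun k => (hadj k).1, fun k => (hc _).eq_iff.1 <|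
      (hright _ _ (hadj k)).trans (hleft _ _ (hadj (k + 1))).symm, fun k ht h => ?_⟩
  · simp only [hper, add_right_comm k n 1]
  · have hlast := hright _ _ (hadj (k + 1))
    rw [← show (w k).1 = (w (k + 1 + 1)).1 from ht] at hlast
    exact hne k <| Prod.ext ht <| (hleft _ _ (hadj k)).symm.trans <|
      ((hc _).eq_of_rel h).trans hlast

section Reachable

variable {ι P : Type*} {L : SimpleGraph ι} {E : ι → Setoid P} {c : ι → P → P}

theorem iSup_rel_of_cosetGraph_reachable (hc : ∀ i, IsSelector (E i) (c i)) {v w : ι × P}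
    (h : (cosetGraph L c).Reachable v w) : (⨆ i, E i) v.2 w.2 := by
  obtain ⟨walk⟩ := h
  induction walk with
  | nil => exact (⨆ i, E i).refl _
  | cons hadj _ ih =>
    obtain ⟨-, p, hu, hv⟩ := hadj
    exact (⨆ i, E i).trans (hu ▸ (⨆ i, E i).symm (le_iSup E _ ((hc _).rel p)))
      ((⨆ i, E i).trans (hv ▸ le_iSup E _ ((hc _).rel p)) ih)

theorem cosetGraph_reachable_iff (hL : L.Preconnected) (hc : ∀ i, IsSelector (E i) (c i)) (i j : ι)
    (p q : P) : (cosetGraph L c).Reachable (i, c i p) (j, c j q) ↔ (⨆ i, E i) p q := by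
  have same_point (k l : ι) (r : P) : (cosetGraph L c).Reachable (k, c k r) (l, c l r) :=
    (hL k l).map (G' := cosetGraph L c) ⟨fun i => (i, c i r), fun h => ⟨h, r, rfl, rfl⟩⟩
  refine ⟨fun h => (⨆ i, E i).trans (le_iSup E i ((hc i).rel p)) <|
    (⨆ i, E i).trans (iSup_rel_of_cosetGraph_reachable hc h)
      ((⨆ i, E i).symm (le_iSup E j ((hc j).rel q))), fun h => ?_⟩
  have hle : ⨆ k, E k ≤ (cosetGraph L c).reachableSetoid.comap fun r => (i, c i r) :=
    iSup_le fun k p q hpq => (same_point i k p).trans ((hc k).eq_of_rel hpq ▸ same_point k i q)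
  exact (hle h).trans (same_point i j q)

theorem measurableSet_cosetGraph_adj [Countable ι] [MeasurableSpace ι] [DiscreteMeasurableSpace ι]
    [MeasurableSpace P] [StandardBorelSpace P] (hE : ∀ i, HasCountableClasses (E i))
    (hcm : ∀ i, Measurable (c i)) (hc : ∀ i, IsSelector (E i) (c i)) :
    MeasurableSet {p : (ι × P) × (ι × P) | (cosetGraph L c).Adj p.1 p.2} := by
  have hcm' : Measurable fun p : ι × P => c p.1 p.2 := measurable_from_prod_countable_right hcm
  have hcoset {f : ((ι × P) × (ι × P)) → ι × P} (hf : Measurable f) :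
      MeasurableSet {q : ((ι × P) × (ι × P)) × P | c (f q.1).1 q.2 = (f q.1).2} :=
    measurableSet_eq_fun
      (hcm'.comp ((hf.comp measurable_fst).fst.prodMk measurable_snd)) (hf.comp measurable_fst).snd
  refine MeasurableSet.inter ((measurable_fst.fst.prodMk measurable_snd.fst)
      (MeasurableSet.of_discrete (s := {p : ι × ι | L.Adj p.1 p.2}))) <|
    measurableSet_exists_mem_of_countable_sections
      ((hcoset measurable_fst).inter (hcoset measurable_snd)) fun ⟨v, w⟩ =>
      (hE v.1 v.2).mono fun p hp => ?_
  exact (E v.1).symm (hp.1 ▸ (hc v.1).rel p)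

end Reachable

variable {P : Type*} {E : Fin 3 → Setoid P} {E₃ : Setoid P}

theorem isReduced_of_alternating (h₁ : E₃ ≤ E 1) (h₂ : E₃ ≤ E 2) {t : ℕ → Fin 3} {x : ℕ → P}
    (ht : ∀ k, t (k + 1) = 1 ∧ t (k + 2) = 2 ∨ t (k + 1) = 2 ∧ t (k + 2) = 1)
    (rel : ∀ k, E (t (k + 2)) (x (k + 1)) (x (k + 2)))
    (not_rel : ∀ k, ¬ E (t (k + 1)) (x (k + 1)) (x (k + 2))) {n : ℕ} (hn : 3 ≤ n) :
    IsReduced (E 1) (E 2) E₃ n x := by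
  have pair (k : ℕ) : E 1 (x (k + 1)) (x (k + 2)) ∨ E 2 (x (k + 1)) (x (k + 2)) := by
    rcases ht k with ⟨-, h⟩ | ⟨-, h⟩
    exacts [.inr (h ▸ rel k), .inl (h ▸ rel k)]
  have not_both {i : Fin 3} (hi : i ≠ 0) (k : ℕ) :
      ¬ (E i (x (k + 1)) (x (k + 2)) ∧ E i (x (k + 2)) (x (k + 3))) := by
    rintro ⟨h, h'⟩
    have : i = t (k + 1) ∨ i = t (k + 2) := by have := ht k; omega
    rcases this with rfl | rfl
    exacts [not_rel k h, not_rel (k + 1) h']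
  have not_common (k : ℕ) : ¬ E₃ (x (k + 1)) (x (k + 2)) := by
    intro h
    rcases ht k with ⟨ht, -⟩ | ⟨ht, -⟩
    exacts [not_rel k (ht ▸ h₁ h), not_rel k (ht ▸ h₂ h)]
  refine ⟨by omega, fun i hi _ => ?_, fun i hi _ => ?_, fun i hi _ => ?_, fun _ i hi _ => ?_,
    by omega⟩
  all_goals obtain ⟨k, rfl⟩ := Nat.exists_eq_add_of_le' hi
  exacts [pair k, not_both one_ne_zero k, not_both (by decide) k, not_common k]

theorem IsAmalgam.cosetGraph_isAcyclic {F : Setoid P} (h : IsAmalgam F (E 1) (E 2) E₃)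
    (hE₀ : E 0 = ⊥) {c : Fin 3 → P → P} (hc : ∀ i, IsSelector (E i) (c i)) :
    (cosetGraph (SimpleGraph.pathGraph 3) c).IsAcyclic := by
  intro v walk hcycle
  obtain ⟨n, t, x, hn, hper, hadj, rel, not_rel⟩ :=
    exists_closed_seq_of_isCycle_cosetGraph hc hcycle
  have hstep (k : ℕ) : (t k).val + 1 = (t (k + 1)).val ∨ (t (k + 1)).val + 1 = (t k).val :=
    SimpleGraph.pathGraph_adj.1 (hadj k)
  have hstep' (k : ℕ) :
      (t (k + 1)).val + 1 = (t (k + 2)).val ∨ (t (k + 2)).val + 1 = (t (k + 1)).val := hstep (k + 1)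
  have not_leaf (k : ℕ) : t (k + 1) ≠ 0 := by
    intro h
    have hx : x k = x (k + 1) := by
      have := rel k
      rwa [h, hE₀] at this
    have hk : t k = t (k + 2) := by have := hstep k; have := hstep' k; omega
    exact not_rel k hk (hx ▸ (E _).refl _)
  have not_leaf' (k : ℕ) : t (k + 2) ≠ 0 := not_leaf (k + 1)
  have alternating (k : ℕ) : t (k + 1) = 1 ∧ t (k + 2) = 2 ∨ t (k + 1) = 2 ∧ t (k + 2) = 1 := by
    have := hstep' k; have := not_leaf k; have := not_leaf' k
    omega
  have period_two (k : ℕ) : t (k + 1) = t (k + 3) := by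
    have := alternating k
    have : t (k + 2) = 1 ∧ t (k + 3) = 2 ∨ t (k + 2) = 2 ∧ t (k + 3) = 1 := alternating (k + 1)
    omega
  have hreduced : IsReduced (E 1) (E 2) E₃ (n + 1) x :=
    isReduced_of_alternating h.le₁ h.le₂ alternating (fun k => rel (k + 1))
      (fun k => not_rel (k + 1) (period_two k)) (by omega)
  exact h.reduced_not_closed _ _ hreduced ((congrArg x (add_comm n 1)).trans (hper 1))

end CosetGraph

section Contraction

/-- The graph obtained from `G` by contracting, for every `x`, the set of vertices `w` with `r w x`
to a single vertex `x`, and by discarding the vertices of `G` that are in none of these sets. -/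
def contraction {W X : Type*} (G : SimpleGraph W) (r : W → X → Prop) : SimpleGraph X where
  Adj x y := x ≠ y ∧ ∃ u v, G.Adj u v ∧ r u x ∧ r v y
  symm := ⟨fun _ _ ⟨hne, u, v, huv, hu, hv⟩ => ⟨hne.symm, v, u, huv.symm, hv, hu⟩⟩
  loopless := ⟨fun _ h => h.1 rfl⟩

variable {W X : Type*} {G : SimpleGraph W} {r : W → X → Prop}

theorem contraction_isAcyclic (hG : G.IsAcyclic) (hr : ∀ ⦃w x y⦄, r w x → r w y → x = y)
    (hconn : ∀ x, (G.induce {w | r w x}).Preconnected) : (contraction G r).IsAcyclic := by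
  rw [SimpleGraph.isAcyclic_iff_forall_adj_isBridge] at hG ⊢
  rintro x y ⟨hxy, u, v, huv, hu, hv⟩
  have hbridge := SimpleGraph.isBridge_iff.1 (hG huv)
  rw [SimpleGraph.isBridge_iff]
  set G' := G.deleteEdges {s(u, v)}
  have adj_of_ne {z z' : X} {w w' : W} (hww' : G.Adj w w') (hw : r w z) (hw' : r w' z')
      (hne : s(z, z') ≠ s(x, y)) : G'.Adj w w' := by
    refine (SimpleGraph.deleteEdges_adj).2 ⟨hww', fun h => hne ?_⟩
    rcases Sym2.eq_iff.1 (mem_singleton_iff.1 h) with ⟨rfl, rfl⟩ | ⟨rfl, rfl⟩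
    · rw [hr hw hu, hr hw' hv]
    · rw [hr hw hv, hr hw' hu, Sym2.eq_swap]
  have part_connected {z : X} {w w' : W} (hw : r w z) (hw' : r w' z) : G'.Reachable w w' := by
    refine (hconn z ⟨w, hw⟩ ⟨w', hw'⟩).map (G' := G')
      ⟨Subtype.val, fun {p q} hpq => adj_of_ne hpq p.2 q.2 fun h => hxy ?_⟩
    rcases Sym2.eq_iff.1 h with ⟨hx, hy⟩ | ⟨hy, hx⟩
    exacts [hx.symm.trans hy, hx.symm.trans hy]
  rintro ⟨walk⟩
  suffices ∀ {z z'}, ((contraction G r).deleteEdges {s(x, y)}).Walk z z' → ∀ {w w'}, r w z →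
      r w' z' → G'.Reachable w w' from hbridge (this walk hu hv)
  intro z z' walk
  induction walk with
  | nil => exact part_connected
  | cons hadj _ ih =>
    intro w w' hw hw'
    obtain ⟨⟨-, p, q, hpq, hp, hq⟩, hne⟩ := SimpleGraph.deleteEdges_adj.1 hadj
    exact (part_connected hw hp).trans ((adj_of_ne hpq hp hq hne).reachable.trans (ih hq hw'))

theorem reachable_of_contraction_reachable (hconn : ∀ x, (G.induce {w | r w x}).Preconnected)
    {x y : X} (h : (contraction G r).Reachable x y) {u v : W} (hu : r u x) (hv : r v y) :
    G.Reachable u v := by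
  have part_connected {z : X} {w w' : W} (hw : r w z) (hw' : r w' z) : G.Reachable w w' :=
    (hconn z ⟨w, hw⟩ ⟨w', hw'⟩).map (SimpleGraph.Embedding.induce _).toHom
  obtain ⟨walk⟩ := h
  induction walk generalizing u with
  | nil => exact part_connected hu hv
  | cons hadj _ ih =>
    obtain ⟨-, p, q, hpq, hp, hq⟩ := hadj
    exact (part_connected hu hp).trans (hpq.reachable.trans (ih hq hv))

theorem contraction_reachable_of_reachable (hr : ∀ ⦃w x y⦄, r w x → r w y → x = y) {u v : W}
    (huv : G.Reachable u v) (hcov : ∀ w, G.Reachable u w → ∃ z, r w z) {x y : X} (hu : r u x)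
    (hv : r v y) : (contraction G r).Reachable x y := by
  obtain ⟨walk⟩ := huv
  induction walk generalizing x with
  | nil => rw [hr hu hv]
  | @cons u w v hadj _ ih =>
    obtain ⟨z, hz⟩ := hcov w hadj.reachable
    have hzy := ih (fun w' hw' => hcov w' (hadj.reachable.trans hw')) hz hv
    rcases eq_or_ne x z with rfl | hne
    · exact hzy
    · have hxz : (contraction G r).Adj x z := ⟨hne, u, w, hadj, hu, hz⟩
      exact hxz.reachable.trans hzy

theorem measurableSet_contraction_adj [MeasurableSpace W] [StandardBorelSpace W]
    [MeasurableSpace X] [StandardBorelSpace X] (hG : MeasurableSet {p : W × W | G.Adj p.1 p.2})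
    (hr : MeasurableSet {p : W × X | r p.1 p.2}) (hrc : ∀ x, {w | r w x}.Countable) :
    MeasurableSet {p : X × X | (contraction G r).Adj p.1 p.2} := by
  have hP : MeasurableSet {q : (X × X) × (W × W) |
      G.Adj q.2.1 q.2.2 ∧ r q.2.1 q.1.1 ∧ r q.2.2 q.1.2} :=
    (measurable_snd hG).inter <|
      ((measurable_snd.fst.prodMk measurable_fst.fst) hr).inter
        ((measurable_snd.snd.prodMk measurable_fst.snd) hr)
  have hc (p : X × X) : {q : W × W | G.Adj q.1 q.2 ∧ r q.1 p.1 ∧ r q.2 p.2}.Countable :=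
    ((hrc p.1).prod (hrc p.2)).mono fun _ hq => hq.2
  convert (measurableSet_eq_fun measurable_fst measurable_snd).compl.inter
    (measurableSet_exists_mem_of_countable_sections hP hc) using 1
  ext p
  simp only [contraction, Prod.exists, mem_inter_iff, mem_compl_iff, mem_ofPred_eq, ne_eq]

end Contraction

section Transfer

/-- The set of vertices of `G` at distance at most `n` from the set `A`. -/
def nearSet {W : Type*} (G : SimpleGraph W) (A : Set W) : ℕ → Set W
  | 0 => A
  | n + 1 => nearSet G A n ∪ {w | ∃ v, G.Adj w v ∧ v ∈ nearSet G A n}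

variable {W : Type*} {G : SimpleGraph W} {A : Set W}

theorem nearSet_mono : Monotone (nearSet G A) :=
  monotone_nat_of_le_succ fun _ => subset_union_left

theorem exists_mem_nearSet {v w : W} (hv : v ∈ A) (h : G.Reachable w v) :
    ∃ n, w ∈ nearSet G A n := by
  obtain ⟨walk⟩ := h
  induction walk with
  | nil => exact ⟨0, hv⟩
  | cons hadj _ ih =>
    obtain ⟨n, hn⟩ := ih hv
    exact ⟨n + 1, .inr ⟨_, hadj, hn⟩⟩

theorem exists_iterate_mem_of_mem_nearSet {s : W → W}
    (hs : ∀ n, ∀ w ∈ nearSet G A (n + 1) \ nearSet G A n, s w ∈ nearSet G A n) {n : ℕ} {w : W}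
    (hw : w ∈ nearSet G A n) : ∃ k, s^[k] w ∈ A := by
  induction n generalizing w with
  | zero => exact ⟨0, hw⟩
  | succ n ih =>
    by_cases h : w ∈ nearSet G A n
    · exact ih h
    · obtain ⟨k, hk⟩ := ih (hs n w ⟨hw, h⟩)
      exact ⟨k + 1, hk⟩

theorem induce_preconnected_of_iterate {s : W → W} (hs : ∀ w, s w = w ∨ G.Adj w (s w)) (v : W) :
    (G.induce {w | ∃ n, s^[n] w = v}).Preconnected := by
  have reachable_end (n : ℕ) (w : W) (hw : s^[n] w = v) :
      (G.induce {w | ∃ n, s^[n] w = v}).Reachable ⟨w, n, hw⟩ ⟨v, 0, rfl⟩ := by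
    induction n generalizing w with
    | zero =>
      obtain rfl : w = v := hw
      rfl
    | succ n ih =>
      have htail := ih (s w) hw
      rcases hs w with h | h
      · simpa only [h] using htail
      · have hstep : (G.induce {w | ∃ n, s^[n] w = v}).Adj ⟨w, n + 1, hw⟩ ⟨s w, n, hw⟩ := h
        exact hstep.reachable.trans htail
  rintro ⟨u, n, hu⟩ ⟨w, m, hw⟩
  exact (reachable_end n u hu).trans (reachable_end m w hw).symm

variable [MeasurableSpace W] [StandardBorelSpace W]

theorem measurableSet_nearSet (hG : MeasurableSet {p : W × W | G.Adj p.1 p.2})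
    (hGc : ∀ w, (G.neighborSet w).Countable) (hA : MeasurableSet A) (n : ℕ) :
    MeasurableSet (nearSet G A n) := by
  induction n with
  | zero => exact hA
  | succ n ih =>
    exact ih.union <| measurableSet_exists_mem_of_countable_sections
      (hG.inter (measurable_snd ih)) fun w => (hGc w).mono fun _ hv => hv.1

theorem exists_measurable_step (hG : MeasurableSet {p : W × W | G.Adj p.1 p.2})
    (hGc : ∀ w, (G.neighborSet w).Countable) (hA : MeasurableSet A) :
    ∃ s : W → W, Measurable s ∧ (∀ w, s w = w ∨ G.Adj w (s w)) ∧ (∀ w ∈ A, s w = w) ∧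
      ∀ n, ∀ w ∈ nearSet G A (n + 1) \ nearSet G A n, s w ∈ nearSet G A n := by
  have hnear (n : ℕ) := measurableSet_nearSet hG hGc hA n
  let D (n : ℕ) : Set W := nearSet G A (n + 1) \ nearSet G A n
  have hD (n : ℕ) : MeasurableSet (D n) := (hnear (n + 1)).diff (hnear n)
  let P : Set (W × W) := (⋃ n, {p | p.1 ∈ D n ∧ G.Adj p.1 p.2 ∧ p.2 ∈ nearSet G A n}) ∪
    {p | p.1 = p.2 ∧ p.1 ∈ (⋃ n, D n)ᶜ}
  have hP : MeasurableSet P := .union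
    (.iUnion fun n => (measurable_fst (hD n)).inter (hG.inter (measurable_snd (hnear n))))
    ((measurableSet_eq_fun measurable_fst measurable_snd).inter
      (measurable_fst (MeasurableSet.iUnion hD).compl))
  have eq_or_adj {w v : W} (h : (w, v) ∈ P) : v = w ∨ G.Adj w v := by
    rcases h with h | h
    · obtain ⟨n, -, h, -⟩ := mem_iUnion.1 h
      exact .inr h
    · exact .inl h.1.symm
  have hPc (w : W) : {v | (w, v) ∈ P}.Countable :=
    ((countable_singleton w).union (hGc w)).mono fun _ => eq_or_adj
  have hne (w : W) : ∃ v, (w, v) ∈ P := by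
    by_cases h : w ∈ ⋃ n, D n
    · obtain ⟨n, hn⟩ := mem_iUnion.1 h
      obtain ⟨v, hv⟩ := hn.1.resolve_left hn.2
      exact ⟨v, .inl (mem_iUnion.2 ⟨n, hn, hv⟩)⟩
    · exact ⟨w, .inr ⟨rfl, h⟩⟩
  obtain ⟨s, hs, hsP⟩ := exists_measurable_uniformization hP hPc hne
  refine ⟨s, hs, fun w => eq_or_adj (hsP w), fun w hw => ?_, fun n w hw => ?_⟩
  · refine ((hsP w).resolve_left fun h => ?_).1.symm
    obtain ⟨n, hn, -⟩ := mem_iUnion.1 h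
    exact hn.2 (nearSet_mono (Nat.zero_le n) hw)
  · obtain ⟨m, hm, -, h⟩ := mem_iUnion.1 <|
      (hsP w).resolve_right fun h => h.2 (mem_iUnion.2 ⟨n, hw⟩)
    have hmn : m < n + 1 := not_le.1 fun hle => hm.2 (nearSet_mono hle hw.1)
    exact nearSet_mono (Nat.le_of_lt_succ hmn) h

theorem IsTreeable.comap {X : Type*} [MeasurableSpace X] [StandardBorelSpace X] {F : Setoid W}
    (hF : IsTreeable F) (hFc : HasCountableClasses F) {a : X → W} (ha : Measurable a)
    (hinj : a.Injective) : IsTreeable (F.comap a) := by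
  obtain ⟨G, hG, hGa, hGF⟩ := hF
  have hGc (w : W) : (G.neighborSet w).Countable :=
    (hFc w).mono fun v hv => (hGF w v).1 (SimpleGraph.Adj.reachable hv)
  have hrange : MeasurableSet (range a) := (ha.measurableEmbedding hinj).measurableSet_range
  obtain ⟨s, hs, hadj, hfix, hnear⟩ := exists_measurable_step hG hGc hrange
  let r (w : W) (x : X) : Prop := ∃ n, s^[n] w = a x
  have hr ⦃w : W⦄ ⦃x y : X⦄ : r w x → r w y → x = y := by
    rintro ⟨n, hx⟩ ⟨m, hy⟩
    have hfix' (z : X) (k : ℕ) : s^[k] (a z) = a z := Function.iterate_fixed (hfix _ ⟨z, rfl⟩) k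
    refine hinj ?_
    rw [← hfix' x m, ← hx, ← Function.iterate_add_apply, add_comm, Function.iterate_add_apply, hy,
      hfix']
  have hconn (x : X) : (G.induce {w | r w x}).Preconnected := induce_preconnected_of_iterate hadj _
  have self (x : X) : r (a x) x := ⟨0, rfl⟩
  refine ⟨contraction G r, ?_, contraction_isAcyclic hGa hr hconn, fun x y => ⟨fun h =>
    (hGF _ _).1 (reachable_of_contraction_reachable hconn h (self x) (self y)), fun h =>
    contraction_reachable_of_reachable hr ((hGF _ _).2 h) (fun w hw => ?_) (self x) (self y)⟩⟩
  · refine measurableSet_contraction_adj hG ?_ fun x => (hFc (a x)).mono fun w hw =>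
      (hGF _ _).1 (reachable_of_contraction_reachable hconn .rfl (self x) hw)
    rw [ofPred_exists]
    exact .iUnion fun n =>
      measurableSet_eq_fun ((hs.iterate n).comp measurable_fst) (ha.comp measurable_snd)
  · obtain ⟨n, hn⟩ := exists_mem_nearSet (mem_range_self x) hw.symm
    obtain ⟨k, y, hy⟩ := exists_iterate_mem_of_mem_nearSet hnear hn
    exact ⟨y, k, hy.symm⟩

end Transfer

section Amalgam

theorem restrict_prod_sup {X : Type*} {R R₁ R₂ S : Setoid X} (hR : R = R₁ ⊔ R₂) (hSR : S ≤ R) :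
    restrict (S.prod R) {p | R p.1 p.2} =
      restrict (S.prod R₁) {p | R p.1 p.2} ⊔ restrict (S.prod R₂) {p | R p.1 p.2} := by
  have hR₁ : R₁ ≤ R := hR ▸ le_sup_left
  have hR₂ : R₂ ≤ R := hR ▸ le_sup_right
  have rel_iff {y y' : X} : R y y' ↔ Relation.EqvGen (fun y y' => R₁ y y' ∨ R₂ y y') y y' := by
    rw [hR, Setoid.sup_eq_eqvGen]
    rfl
  refine le_antisymm ?_ (sup_le (fun _ _ hpq => ⟨hpq.1, hR₁ hpq.2⟩)
    fun _ _ hpq => ⟨hpq.1, hR₂ hpq.2⟩)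
  set E := restrict (S.prod R₁) {p | R p.1 p.2} ⊔ restrict (S.prod R₂) {p | R p.1 p.2}
  have hE₁ : restrict (S.prod R₁) {p | R p.1 p.2} ≤ E := le_sup_left
  have hE₂ : restrict (S.prod R₂) {p | R p.1 p.2} ≤ E := le_sup_right
  have vertical {x y y' : X} (hyy' : Relation.EqvGen (fun y y' => R₁ y y' ∨ R₂ y y') y y')
      (hxy : R x y) (hxy' : R x y') : E ⟨(x, y), hxy⟩ ⟨(x, y'), hxy'⟩ := by
    induction hyy' with
    | rel y y' hyy' => exact hyy'.elim (fun h => hE₁ ⟨S.refl x, h⟩) fun h => hE₂ ⟨S.refl x, h⟩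
    | refl => exact E.refl _
    | symm _ _ _ ih => exact E.symm (ih hxy' hxy)
    | trans y z y' hyz _ ih ih' =>
      have hxz : R x z := R.trans hxy (rel_iff.2 hyz)
      exact E.trans (ih hxy hxz) (ih' hxz hxy')
  rintro ⟨⟨x, y⟩, hxy⟩ ⟨⟨x', y'⟩, hxy'⟩ ⟨hxx', hyy'⟩
  have hx'y : R x' y := R.trans (R.symm (hSR hxx')) hxy
  have horizontal : E ⟨(x, y), hxy⟩ ⟨(x', y), hx'y⟩ := hE₁ ⟨hxx', R₁.refl y⟩
  exact E.trans horizontal (vertical (rel_iff.1 hyy') hx'y hxy')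

theorem IsAmalgam.restrict_prod {X : Type*} {R R₁ R₂ R₃ S : Setoid X} (h : IsAmalgam R R₁ R₂ R₃)
    (hSR : S ≤ R) :
    IsAmalgam (restrict (S.prod R) {p | R p.1 p.2}) (restrict (S.prod R₁) {p | R p.1 p.2})
      (restrict (S.prod R₂) {p | R p.1 p.2}) (restrict (S.prod R₃) {p | R p.1 p.2}) where
  le₁ _ _ hpq := ⟨hpq.1, h.le₁ hpq.2⟩
  le₂ _ _ hpq := ⟨hpq.1, h.le₂ hpq.2⟩
  generated := restrict_prod_sup h.generated hSR
  reduced_not_closed n p hp := by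
    rcases hp.two_le.eq_or_lt with rfl | hn
    · exact (hp.ne_of_two rfl).symm
    have hS (i : ℕ) (hi : 1 ≤ i) (hin : i + 1 ≤ n) : S (p i).1.1 (p (i + 1)).1.1 :=
      (hp.pair i hi hin).elim And.left And.left
    have hreduced : IsReduced R₁ R₂ R₃ n fun i => (p i).1.2 :=
      ⟨hp.two_le, fun i hi hin => (hp.pair i hi hin).imp And.right And.right,
        fun i hi hin hQ => hp.not_both₁ i hi hin
          ⟨⟨hS i hi (by omega), hQ.1⟩, hS (i + 1) (by omega) hin, hQ.2⟩,
        fun i hi hin hQ => hp.not_both₂ i hi hin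
          ⟨⟨hS i hi (by omega), hQ.1⟩, hS (i + 1) (by omega) hin, hQ.2⟩,
        fun _ i hi hin hQ => hp.not_common hn i hi hin ⟨hS i hi hin, hQ⟩, by omega⟩
    exact fun h' => h.reduced_not_closed n _ hreduced (congrArg (fun q => q.1.2) h')

theorem IsAmalgam.isTreeable_of_isSmooth {P : Type*} [MeasurableSpace P] [StandardBorelSpace P]
    {F F₁ F₂ F₃ : Setoid P} (h : IsAmalgam F F₁ F₂ F₃) (hFc : HasCountableClasses F)
    (hF₁ : IsBorel F₁) (hF₂ : IsBorel F₂) (hs₁ : IsSmooth F₁) (hs₂ : IsSmooth F₂) :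
    IsTreeable F := by
  obtain ⟨c₁, hcm₁, hc₁⟩ := hs₁.exists_isSelector hF₁
  obtain ⟨c₂, hcm₂, hc₂⟩ := hs₂.exists_isSelector hF₂
  let E : Fin 3 → Setoid P := ![⊥, F₁, F₂]
  let c : Fin 3 → P → P := ![id, c₁, c₂]
  have hc : ∀ i, IsSelector (E i) (c i) :=
    Fin.forall_fin_succ.2 ⟨⟨fun _ => rfl, id⟩, Fin.forall_fin_two.2 ⟨hc₁, hc₂⟩⟩
  have hcm : ∀ i, Measurable (c i) :=
    Fin.forall_fin_succ.2 ⟨measurable_id, Fin.forall_fin_two.2 ⟨hcm₁, hcm₂⟩⟩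
  have hle : ∀ i, E i ≤ F := by
    rw [h.generated]
    exact Fin.forall_fin_succ.2 ⟨bot_le, Fin.forall_fin_two.2 ⟨le_sup_left, le_sup_right⟩⟩
  have hsup : ⨆ i, E i = F := le_antisymm (iSup_le hle) <|
    h.generated ▸ sup_le (le_iSup E 1) (le_iSup E 2)
  have hEc (i : Fin 3) : HasCountableClasses (E i) := hFc.mono (hle i)
  let G := cosetGraph (SimpleGraph.pathGraph 3) c
  have hG : IsTreeable G.reachableSetoid :=
    ⟨G, measurableSet_cosetGraph_adj hEc hcm hc, IsAmalgam.cosetGraph_isAcyclic (E := E) h rfl hc,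
      fun _ _ => Iff.rfl⟩
  have hGc : HasCountableClasses G.reachableSetoid := by
    rw [← hsup] at hFc
    exact fun v => (countable_univ.prod (hFc v.2)).mono fun w hw =>
      mk_mem_prod (mem_univ w.1) (iSup_rel_of_cosetGraph_reachable hc hw)
  have hcomap : G.reachableSetoid.comap (Prod.mk 0) = F := Setoid.ext fun p q => by
    rw [← hsup]
    exact cosetGraph_reachable_iff (SimpleGraph.pathGraph_preconnected 3) hc 0 0 p q
  exact hcomap ▸ hG.comap hGc measurable_prodMk_left (Prod.mk_right_injective 0)

end Amalgam

end BorelRel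

theorem proposition29 {X : Type*} [MeasurableSpace X] [StandardBorelSpace X]
    (R R₁ R₂ R₃ S : Setoid X)
    (hR : BorelRel.IsBorel R) (hRc : BorelRel.HasCountableClasses R)
    (hR₁ : BorelRel.IsBorel R₁) (hR₂ : BorelRel.IsBorel R₂) (hR₃ : BorelRel.IsBorel R₃)
    (hamalgam : BorelRel.IsAmalgam R R₁ R₂ R₃)
    (hS : BorelRel.IsBorel S) (hSR : S ≤ R)
    (hsmooth : ∀ φ : PartialEquiv X X, BorelRel.MemFullPseudogroup R φ →
      BorelRel.IsSmooth (BorelRel.conj φ R₁ ⊓ BorelRel.restrict S φ.source) ∧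
      BorelRel.IsSmooth (BorelRel.conj φ R₂ ⊓ BorelRel.restrict S φ.source)) :
    BorelRel.IsTreeable S := by
  have hRstd : StandardBorelSpace {p : X × X | R p.1 p.2} := MeasurableSet.standardBorel hR
  have hc : BorelRel.HasCountableClasses (BorelRel.restrict (S.prod R) {p | R p.1 p.2}) :=
    ((hRc.prod hRc).restrict _).mono (BorelRel.restrict_prod_le hSR)
  have htree : BorelRel.IsTreeable (BorelRel.restrict (S.prod R) {p | R p.1 p.2}) :=
    (hamalgam.restrict_prod hSR).isTreeable_of_isSmooth hc
      ((hS.prod hR₁).restrict _) ((hS.prod hR₂).restrict _)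
      (BorelRel.isSmooth_restrict_prod hR hRc hS hSR hR₁ fun φ hφ => (hsmooth φ hφ).1)
      (BorelRel.isSmooth_restrict_prod hR hRc hS hSR hR₂ fun φ hφ => (hsmooth φ hφ).2)
  let diag (x : X) : {p : X × X | R p.1 p.2} := ⟨(x, x), R.refl x⟩
  have hdiag : Measurable diag := (measurable_id.prodMk measurable_id).subtype_mk
  have hinj : diag.Injective := fun x y h => congrArg (fun p => p.1.1) h
  have hcomap : (BorelRel.restrict (S.prod R) {p | R p.1 p.2}).comap diag = S :=
    Setoid.ext fun x y => ⟨fun h => h.1, fun h => ⟨h, hSR h⟩⟩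
  exact hcomap ▸ htree.comap hc hdiag hinj
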